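/- Let $M, d_1,\dots,d_M\in\mathbb{N}$ and, for $i=1,\dots,M$, let $\Omega_i\subset\mathbb{R}^{d_i}$ and let $K_i:\mathbb{R}^{d_i}\times\mathbb{R}^{d_i}\to\mathbb{R}$ be a positive semi-definite kernel (i.e. for all finitely many pairwise distinct points $x_1,\dots,x_n$ the matrix $(K_i(x_j,x_k))_{j,k}$ is symmetric and positive semi-definite). Let $\Omega=\Omega_1\times\dots\times\Omega_M\subset\mathbb{R}^{d_1}\times\dots\times\mathbb{R}^{d_M}\simeq\mathbb{R}^{d}$, $d=\sum_i d_i$, and let $K(x,y)=\prod_{i=1}^M K_i(x^i,y^i)$ be the product kernel, where $x^i$ denotes the $i$-th component of $x$. For a positive semi-definite kernel $L$ and a subset $S$ of its domain, let $\mathcal{H}_{L,S}$ denote the native space, i.e. the reproducing kernel Hilbert space of real functions on $S$ with reproducing kernel $L|_{S\times S}$. A Hilbert tensor product of real Hilbert spaces $\mathcal{H}_1,\dots,\mathcal{H}_M$ is a pair $(\mathcal{H},\varphi)$ of a real Hilbert space $\mathcal{H}$ and a multilinear map $\varphi:\mathcal{H}_1\times\dots\times\mathcal{H}_M\to\mathcal{H}$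 such that $$\langle\varphi(x_1,\dots,x_M),\varphi(y_1,\dots,y_M)\rangle_{\mathcal{H}}=\prod_{i=1}^M\langle x_i,y_i\rangle_{\mathcal{H}_i}$$ for all $x_i,y_i\in\mathcal{H}_i$, and such that the linear span of the range of $\varphi$ is dense in $\mathcal{H}$. Then the map $$\varphi:\mathcal{H}_{K_1,\Omega_1}\times\dots\times\mathcal{H}_{K_M,\Omega_M}\to\mathcal{H}_{K,\Omega},\qquad \varphi(f_1,\dots,f_M)(x)=\prod_{i=1}^M f_i(x^i)\quad(x\in\Omega),$$ is well defined and multilinear, and $(\mathcal{H}_{K,\Omega},\varphi)$ is a Hilbert tensor product of $\mathcal{H}_{K_1,\Omega_1},\dots,\mathcal{H}_{K_M,\Omega_M}$. Moreover, for every Hilbert tensor product $(T,\psi)$ of these spaces there is a linear isometric isomorphism $U:T\to\mathcal{H}_{K,\Omega}$ with $U\circ\psi=\varphi$. -/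

import Mathlib

noncomputable section

/-- The interpolation matrix `A_{K,X} = (K (x_i) (x_j))_{i,j}` of a kernel `K` at the points
`x_1, …, x_n`. -/
def interpolationMatrix {X : Type*} (K : X → X → ℝ) {n : ℕ} (x : Fin n → X) :
    Matrix (Fin n) (Fin n) ℝ :=
  Matrix.of fun i j => K (x i) (x j)

/-- A kernel is positive semi-definite if, for any finitely many pairwise distinct points, the
interpolation matrix is symmetric and positive semi-definite (over `ℝ`, Mathlib's
`Matrix.PosSemidef` contains the symmetry). -/
def IsPosSemidefKernel {X : Type*} (K : X → X → ℝ) : Prop :=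
  ∀ (n : ℕ) (x : Fin n → X), Function.Injective x → (interpolationMatrix K x).PosSemidef

/-- The positive semi-definite kernels on `X`. -/
structure PosSemidefKernel (X : Type*) where
  /-- The underlying function of two variables. -/
  toFun : X → X → ℝ
  /-- Positive semi-definiteness. -/
  posSemidef : IsPosSemidefKernel toFun

/-- The kernel, seen as an `X × X` matrix, is positive semi-definite in Mathlib's sense. -/
theorem isPosSemidefKernel_iff {X : Type*} (K : X → X → ℝ) :
    IsPosSemidefKernel K ↔ (Matrix.of K).PosSemidef := by
  constructor
  · intro h
    have key : ∀ s : Finset X, ((Matrix.of K).submatrix (Subtype.val : s → X)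
        (Subtype.val : s → X)).PosSemidef := by
      intro s
      have := h _ (fun i => ((s.equivFin.symm i : s) : X))
        (Subtype.val_injective.comp s.equivFin.symm.injective)
      have h2 := this.submatrix s.equivFin
      convert h2 using 1
      ext i j
      simp [interpolationMatrix]
    refine ⟨?_, fun c => ?_⟩
    · classical
      ext x y
      have := (key {x, y}).1.apply ⟨x, by simp⟩ ⟨y, by simp⟩
      simpa using this
    · have := (Matrix.posSemidef_iff_dotProduct_mulVec.mp (key c.support)).2 (fun i => c i)
      convert this using 1
      simp only [Finsupp.sum, dotProduct, Matrix.mulVec, Matrix.submatrix_apply, Finset.mul_sum,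
        Pi.star_apply]
      rw [← Finset.sum_coe_sort]
      refine Finset.sum_congr rfl fun i _ => ?_
      rw [← Finset.sum_coe_sort]
      refine Finset.sum_congr rfl fun j _ => ?_
      ring
  · intro h n x _
    exact h.submatrix x

namespace PosSemidefKernel

/-- The restriction of a positive semi-definite kernel to a subset `Ω`. -/
def restrict {X : Type*} (K : PosSemidefKernel X) (Ω : Set X) : PosSemidefKernel Ω where
  toFun x y := K.toFun x y
  posSemidef n x hx := K.posSemidef n (fun i => (x i : X)) (Subtype.val_injective.comp hx)

/-- The product kernel `K (x, y) = ∏ i, K_i (x^i, y^i)` on the Cartesian product, where `x^i` is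
the `i`-th projection `x i` of `x`. -/
def prod {ι : Type*} [Fintype ι] {X : ι → Type*} (K : ∀ i, PosSemidefKernel (X i)) :
    PosSemidefKernel (∀ i, X i) where
  toFun x y := ∏ i, (K i).toFun (x i) (y i)
  posSemidef := by
    classical
    rw [isPosSemidefKernel_iff]
    suffices H : ∀ s : Finset ι, (Matrix.of fun x y : ∀ i, X i =>
        ∏ i ∈ s, (K i).toFun (x i) (y i)).PosSemidef from H Finset.univ
    intro s
    induction s using Finset.induction_on with
    | empty =>
      rw [← isPosSemidefKernel_iff]
      intro n x _
      have : interpolationMatrix (fun x y : ∀ i, X i =>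
          ∏ i ∈ (∅ : Finset ι), (K i).toFun (x i) (y i)) x =
          Matrix.vecMulVec (fun _ => (1 : ℝ)) (star fun _ => (1 : ℝ)) := by
        ext i j
        simp [interpolationMatrix, Matrix.vecMulVec]
      rw [this]
      exact Matrix.posSemidef_vecMulVec_self_star _
    | insert a s ha ih =>
      have h1 := ((isPosSemidefKernel_iff _).1 (K a).posSemidef).submatrix
        (fun x : ∀ i, X i => x a)
      have h2 := h1.hadamard ih
      have e : (Matrix.of fun x y : ∀ i, X i => ∏ i ∈ insert a s, (K i).toFun (x i) (y i)) =
          ((Matrix.of (K a).toFun).submatrix (fun x : ∀ i, X i => x a) fun x => x a).hadamard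
            (Matrix.of fun x y => ∏ i ∈ s, (K i).toFun (x i) (y i)) := by
        ext x y
        simp [Finset.prod_insert ha]
      rw [e]
      exact h2

/-- A scalar kernel as an operator-valued matrix: the value `K x y` acts on `ℝ` by
multiplication. This is the format of kernels in Mathlib's theory of (vector-valued) reproducing
kernel Hilbert spaces. -/
def opMatrix {X : Type*} (K : PosSemidefKernel X) : Matrix X X (ℝ →L[ℝ] ℝ) :=
  Matrix.of fun x y => K.toFun x y • ContinuousLinearMap.id ℝ ℝ

instance factPosSemidefOpMatrix {X : Type*} (K : PosSemidefKernel X) :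
    Fact K.opMatrix.PosSemidef := by
  have hK := (isPosSemidefKernel_iff _).1 K.posSemidef
  constructor
  have tfae := (RKHS.posSemidef_tfae (K := K.opMatrix)).out 0 2
  refine tfae.2 ⟨?_, fun v => ?_⟩
  · ext x y
    have := hK.1.apply x y
    simp only [Matrix.of_apply, star_trivial] at this
    have h1 : star (ContinuousLinearMap.id ℝ ℝ) = ContinuousLinearMap.id ℝ ℝ :=
      star_one (ℝ →L[ℝ] ℝ)
    simp [opMatrix, this, h1]
  · have := hK.2 v
    refine this.trans_eq ?_
    simp only [Finsupp.sum, RCLike.re_to_real]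
    rw [Finset.sum_comm]
    refine Finset.sum_congr rfl fun i _ => Finset.sum_congr rfl fun j _ => ?_
    simp [opMatrix, mul_assoc]

/-- The native space `𝓗_{K,Ω}`: the reproducing kernel Hilbert space of functions `Ω → ℝ`
generated by the restriction of `K` to `Ω`, that is, Mathlib's (Hausdorff) completion of the finite
linear combinations of the kernel functions `K (·, x)`, `x ∈ Ω`, under the inner product with
`⟨K (·, x), K (·, y)⟩ = K (x, y)`. Its elements act as functions on `Ω`: for
`f : K.NativeSpace Ω` and `x : Ω`, the value is `f x`. -/
abbrev NativeSpace {X : Type*} (K : PosSemidefKernel X) (Ω : Set X) : Type _ :=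
  RKHS.OfKernel (K.restrict Ω).opMatrix

end PosSemidefKernel

/-- `(T, φ)` is a Hilbert tensor product of the real Hilbert spaces `H i`: `T` is a real Hilbert
space, `φ` is multilinear, inner products of tensors are the products of the component inner
products, and the tensors span a dense subspace. -/
structure IsHilbertTensorProduct {ι : Type*} [Fintype ι] {H : ι → Type*}
    [∀ i, NormedAddCommGroup (H i)] [∀ i, InnerProductSpace ℝ (H i)] [∀ i, CompleteSpace (H i)]
    {T : Type*} [NormedAddCommGroup T] [InnerProductSpace ℝ T] [CompleteSpace T]
    (φ : MultilinearMap ℝ H T) : Prop where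
  inner_map_map : ∀ x y : ∀ i, H i, inner ℝ (φ x) (φ y) = ∏ i, inner ℝ (x i) (y i)
  dense_span : Dense (Submodule.span ℝ (Set.range φ) : Set T)

end

open scoped InnerProductSpace

/-! The delicate point is that a product of functions `f i` lies in the native space of the product
kernel. A function `F` belongs to an RKHS with kernel `K`, with norm at most `C`, as soon as `C ^ 2
* K - F ⊗ F` is positive semi-definite (`exists_eq_of_posSemidef`); conversely Cauchy–Schwarz gives
this domination for each `f i` with `C = ‖f i‖`. The Schur product theorem multiplies the
dominations together, so the tensor map exists and is bounded by `∏ i, ‖f i‖`.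

The tensor map sends tuples of kernel functions to kernel functions, so its range spans a dense
subspace. The inner product formula holds on such tuples by the reproducing property, and extends to
all tuples by continuity and multilinearity. Uniqueness holds because the formula fixes the Gram
matrix of the tensors. -/

/-- Schur products preserve the order between positive semi-definite matrices. -/
theorem Matrix.PosSemidef.prod_sub_prod {Y ι : Type*} (s : Finset ι) (A B : ι → Matrix Y Y ℝ)
    (hB : ∀ i, (B i).PosSemidef) (hAB : ∀ i, (A i - B i).PosSemidef) :
    (Matrix.of fun x y => ∏ i ∈ s, B i x y).PosSemidef ∧
      (Matrix.of fun x y => ∏ i ∈ s, A i x y - ∏ i ∈ s, B i x y).PosSemidef := by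
  classical
  induction s using Finset.induction_on with
  | empty =>
    constructor
    · refine ⟨by ext; simp, fun c => ?_⟩
      have h : (c.sum fun i xi => c.sum fun j xj => star xi *
          (Matrix.of fun x y : Y => ∏ k ∈ (∅ : Finset ι), B k x y) i j * xj) =
          (c.sum fun _ z => z) * (c.sum fun _ z => z) := by
        simp [Finsupp.sum, Finset.sum_mul_sum]
      exact (mul_self_nonneg _).trans_eq h.symm
    · simpa using! Matrix.PosSemidef.zero (n := Y) (R := ℝ)
  | insert a s ha ih =>
    have hA : (A a).PosSemidef := by simpa using (hAB a).add (hB a)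
    have e1 : (Matrix.of fun x y => ∏ i ∈ insert a s, B i x y) =
        (B a).hadamard (Matrix.of fun x y => ∏ i ∈ s, B i x y) := by
      ext x y
      simp [Finset.prod_insert ha]
    -- Telescoping: `A∘P - B∘Q = A∘(P - Q) + (A - B)∘Q`, both terms being Schur products of positive
    -- semi-definite matrices.
    have e2 : (Matrix.of fun x y => ∏ i ∈ insert a s, A i x y - ∏ i ∈ insert a s, B i x y) =
        (A a).hadamard (Matrix.of fun x y => ∏ i ∈ s, A i x y - ∏ i ∈ s, B i x y) +
          (A a - B a).hadamard (Matrix.of fun x y => ∏ i ∈ s, B i x y) := by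
      ext x y
      simp only [Matrix.of_apply, Finset.prod_insert ha, Matrix.add_apply, Matrix.hadamard_apply,
        Matrix.sub_apply]
      ring
    rw [e1, e2]
    exact ⟨(hB a).hadamard ih.1, (hA.hadamard ih.2).add ((hAB a).hadamard ih.1)⟩

/-- Two continuous multilinear maps which agree on all tuples taken from sets with dense span are
equal. -/
theorem ContinuousMultilinearMap.ext_of_dense_span {ι : Type*} [Fintype ι] {E : ι → Type*}
    {F : Type*} [∀ i, NormedAddCommGroup (E i)] [∀ i, NormedSpace ℝ (E i)]
    [NormedAddCommGroup F] [NormedSpace ℝ F] {S : ∀ i, Set (E i)}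
    (hS : ∀ i, Dense (Submodule.span ℝ (S i) : Set (E i)))
    {A B : ContinuousMultilinearMap ℝ E F} (h : ∀ g : ∀ i, E i, (∀ i, g i ∈ S i) → A g = B g) :
    A = B := by
  classical
  -- The coordinates in `s` are arbitrary, the others still lie in `S i`; each induction step frees
  -- one coordinate.
  have key : ∀ s : Finset ι, ∀ g : ∀ i, E i, (∀ i ∉ s, g i ∈ S i) → A g = B g := by
    intro s
    induction s using Finset.induction_on with
    | empty => exact fun g hg => h g fun i => hg i (Finset.notMem_empty i)
    | insert a s ha ih =>
      intro g hg
      have : A.toContinuousLinearMap g a = B.toContinuousLinearMap g a := by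
        refine ContinuousLinearMap.ext_on (hS a) fun t ht => ?_
        refine ih (Function.update g a t) fun i hi => ?_
        by_cases hia : i = a
        · subst hia
          simpa using ht
        · rw [Function.update_of_ne hia]
          exact hg i (by simp [hia, hi])
      simpa using DFunLike.congr_fun this (g a)
  ext g
  exact key Finset.univ g fun i hi => absurd (Finset.mem_univ i) hi

namespace RKHS

/-! ### Membership in an RKHS through kernel domination -/

section Scalar

variable {X H : Type*} [NormedAddCommGroup H] [InnerProductSpace ℝ H] [CompleteSpace H]
  [RKHS ℝ H X ℝ]

variable (H) in
/-- The span of the kernel functions `K (·, x)` of a real reproducing kernel Hilbert space is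
dense. -/
theorem dense_span_range_kerFun_one :
    Dense (Submodule.span ℝ (Set.range fun x : X => kerFun H x 1) : Set H) := by
  rw [Submodule.dense_iff_topologicalClosure_eq_top, ← top_le_iff, ← kerFun_dense (H := H)]
  refine Submodule.topologicalClosure_mono (Submodule.span_le.2 ?_)
  rintro _ ⟨x, v, rfl⟩
  have : kerFun H x v = v • kerFun H x 1 := by rw [← map_smul]; simp
  rw [this]
  exact Submodule.smul_mem _ _ (Submodule.subset_span ⟨x, rfl⟩)

theorem inner_kerFun_one (f : H) (x : X) : ⟪f, kerFun H x 1⟫_ℝ = f x := by simp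

/-- The rank one kernel `f ⊗ f` is dominated by `‖f‖ ^ 2` times the reproducing kernel. -/
theorem posSemidef_norm_sq_mul_sub (f : H) :
    (Matrix.of fun x y : X =>
      ‖f‖ ^ 2 * ⟪kerFun H x 1, kerFun H y 1⟫_ℝ - f x * f y).PosSemidef := by
  refine ⟨?_, fun c => ?_⟩
  · ext x y
    simp only [Matrix.conjTranspose_apply, Matrix.of_apply, star_trivial]
    rw [real_inner_comm, mul_comm (f y)]
  · set v : H := c.sum fun x z => z • kerFun H x 1 with hv
    have h1 : ⟪f, v⟫_ℝ = c.sum fun x z => z * f x := by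
      simp only [hv, Finsupp.sum, inner_sum, real_inner_smul_right, inner_kerFun_one]
    have h2 : ⟪v, v⟫_ℝ = c.sum fun x z => c.sum fun y w =>
        z * (w * ⟪kerFun H x 1, kerFun H y 1⟫_ℝ) := by
      conv_lhs => rw [hv]
      simp only [Finsupp.sum, inner_sum, sum_inner, real_inner_smul_right, real_inner_smul_left]
      rw [Finset.sum_comm]
      refine Finset.sum_congr rfl fun x _ => Finset.sum_congr rfl fun y _ => ?_
      ring
    -- The quadratic form at `c` is `‖f‖ ^ 2 * ‖v‖ ^ 2 - ⟪f, v⟫ ^ 2`, so Cauchy–Schwarz is the whole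
    -- claim.
    have h3 := real_inner_mul_inner_self_le f v
    have h4 : (c.sum fun x z => c.sum fun y w => star z * (Matrix.of fun x y : X =>
        ‖f‖ ^ 2 * ⟪kerFun H x 1, kerFun H y 1⟫_ℝ - f x * f y) x y * w) =
        ‖f‖ ^ 2 * ⟪v, v⟫_ℝ - ⟪f, v⟫_ℝ * ⟪f, v⟫_ℝ := by
      rw [h1, h2]
      simp only [Finsupp.sum, Finset.sum_mul_sum]
      simp only [Finset.mul_sum, ← Finset.sum_sub_distrib]
      refine Finset.sum_congr rfl fun x _ => Finset.sum_congr rfl fun y _ => ?_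
      simp only [star_trivial, Matrix.of_apply]
      ring
    rw [h4, ← real_inner_self_eq_norm_sq]
    linarith

/-- A function whose rank one kernel is dominated by `C ^ 2` times the reproducing kernel belongs
to the reproducing kernel Hilbert space, with norm at most `C`. -/
theorem exists_eq_of_posSemidef (F : X → ℝ) {C : ℝ} (hC : 0 ≤ C)
    (h : (Matrix.of fun x y : X =>
      C ^ 2 * ⟪kerFun H x 1, kerFun H y 1⟫_ℝ - F x * F y).PosSemidef) :
    ∃ f : H, (∀ x, f x = F x) ∧ ‖f‖ ≤ C := by
  set e : (X →₀ ℝ) →ₗ[ℝ] H := Finsupp.linearCombination ℝ fun x => kerFun H x 1 with he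
  set l : (X →₀ ℝ) →ₗ[ℝ] ℝ := Finsupp.linearCombination ℝ F with hl
  have hd : DenseRange e := by
    have := dense_span_range_kerFun_one H
    rwa [← Finsupp.range_linearCombination] at this
  -- The sought `f` must satisfy `⟪f, e c⟫ = l c`. Domination is exactly this bound, so `l` factors
  -- through `e`, extends continuously to `H`, and Riesz yields `f`.
  have hb : ∀ c, ‖l c‖ ≤ C * ‖e c‖ := by
    intro c
    have h4 : (c.sum fun x z => c.sum fun y w => star z * (Matrix.of fun x y : X =>
        C ^ 2 * ⟪kerFun H x 1, kerFun H y 1⟫_ℝ - F x * F y) x y * w) =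
        C ^ 2 * ⟪e c, e c⟫_ℝ - l c * l c := by
      simp only [he, hl, Finsupp.linearCombination_apply, Finsupp.sum, inner_sum, sum_inner,
        real_inner_smul_right, real_inner_smul_left, Finset.sum_mul_sum]
      simp only [Finset.mul_sum]
      rw [Finset.sum_comm (f := fun x y => C ^ 2 * _)]
      simp only [← Finset.sum_sub_distrib]
      refine Finset.sum_congr rfl fun x _ => Finset.sum_congr rfl fun y _ => ?_
      simp only [star_trivial, Matrix.of_apply, smul_eq_mul]
      ring
    have h5 := h.2 c
    rw [h4, real_inner_self_eq_norm_sq] at h5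
    rw [Real.norm_eq_abs]
    refine abs_le_of_sq_le_sq ?_ (by positivity)
    linarith [sq (l c), mul_pow C ‖e c‖ 2]
  refine ⟨(InnerProductSpace.toDual ℝ H).symm (l.extendOfNorm e), fun x => ?_, ?_⟩
  · rw [← inner_kerFun_one, InnerProductSpace.toDual_symm_apply]
    have := LinearMap.extendOfNorm_eq hd ⟨C, hb⟩ (Finsupp.single x 1)
    simpa [he, hl] using this
  · rw [LinearIsometryEquiv.norm_map]
    exact LinearMap.opNorm_extendOfNorm_le hd hC hb

end Scalar

/-! ### The tensor map on RKHSs -/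

section Tensor

/-- The multilinear map `f ↦ ∏ i, f i (x i)`. -/
noncomputable def prodEval {ι : Type*} [Fintype ι] {X : ι → Type*} (H : ι → Type*)
    [∀ i, NormedAddCommGroup (H i)] [∀ i, InnerProductSpace ℝ (H i)] [∀ i, RKHS ℝ (H i) (X i) ℝ]
    (x : ∀ i, X i) : MultilinearMap ℝ H ℝ :=
  (MultilinearMap.mkPiAlgebra ℝ ι ℝ).compLinearMap fun i =>
    LinearMap.proj (x i) ∘ₗ (coeCLM ℝ : H i →L[ℝ] X i → ℝ).toLinearMap

theorem prodEval_apply {ι : Type*} [Fintype ι] {X : ι → Type*} {H : ι → Type*}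
    [∀ i, NormedAddCommGroup (H i)] [∀ i, InnerProductSpace ℝ (H i)] [∀ i, RKHS ℝ (H i) (X i) ℝ]
    (x : ∀ i, X i) (f : ∀ i, H i) : prodEval H x f = ∏ i, f i (x i) := by
  simp [prodEval]

variable {ι : Type*} [Fintype ι] {X : ι → Type*} {H : ι → Type*}
  [∀ i, NormedAddCommGroup (H i)] [∀ i, InnerProductSpace ℝ (H i)] [∀ i, CompleteSpace (H i)]
  [∀ i, RKHS ℝ (H i) (X i) ℝ]
  {Y G : Type*} [NormedAddCommGroup G] [InnerProductSpace ℝ G] [CompleteSpace G] [RKHS ℝ G Y ℝ]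
  {p : Y → ∀ i, X i}

/-- If the kernel of `G` is the product of the kernels of the `H i`, then products of functions in
the `H i` belong to `G`. -/
theorem exists_eq_prod
    (hK : ∀ x y : Y, ⟪kerFun G x 1, kerFun G y 1⟫_ℝ =
      ∏ i, ⟪kerFun (H i) (p x i) 1, kerFun (H i) (p y i) 1⟫_ℝ) (f : ∀ i, H i) :
    ∃ g : G, (∀ x, g x = ∏ i, f i (p x i)) ∧ ‖g‖ ≤ ∏ i, ‖f i‖ := by
  refine exists_eq_of_posSemidef _ (by positivity) ?_
  have hB : ∀ i, (Matrix.of fun x y : Y => f i (p x i) * f i (p y i)).PosSemidef := by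
    intro i
    refine ⟨by ext; simp [mul_comm], fun c => ?_⟩
    have h : (c.sum fun x z => c.sum fun y w => star z *
        (Matrix.of fun x y : Y => f i (p x i) * f i (p y i)) x y * w) =
        (c.sum fun x z => z * f i (p x i)) * (c.sum fun x z => z * f i (p x i)) := by
      simp only [Finsupp.sum, Finset.sum_mul_sum]
      refine Finset.sum_congr rfl fun x _ => Finset.sum_congr rfl fun y _ => ?_
      simp only [star_trivial, Matrix.of_apply]
      ring
    exact (mul_self_nonneg _).trans_eq h.symm
  have hAB : ∀ i, ((Matrix.of fun x y : Y =>
      ‖f i‖ ^ 2 * ⟪kerFun (H i) (p x i) 1, kerFun (H i) (p y i) 1⟫_ℝ) -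
        Matrix.of fun x y : Y => f i (p x i) * f i (p y i)).PosSemidef :=
    fun i => (posSemidef_norm_sq_mul_sub (f i)).submatrix fun x : Y => p x i
  convert (Matrix.PosSemidef.prod_sub_prod Finset.univ (fun i => Matrix.of fun x y : Y =>
    ‖f i‖ ^ 2 * ⟪kerFun (H i) (p x i) 1, kerFun (H i) (p y i) 1⟫_ℝ) _ hB hAB).2 using 1
  ext x y
  simp only [Matrix.of_apply, hK, Finset.prod_mul_distrib, Finset.prod_pow]

/-- The tensor product map of reproducing kernel Hilbert spaces into the reproducing kernel
Hilbert space of the product kernel, sending a tuple of functions to their pointwise product. -/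
noncomputable def tensorMap (hK : ∀ x y : Y, ⟪kerFun G x 1, kerFun G y 1⟫_ℝ =
      ∏ i, ⟪kerFun (H i) (p x i) 1, kerFun (H i) (p y i) 1⟫_ℝ) :
    ContinuousMultilinearMap ℝ H G :=
  MultilinearMap.mkContinuous
    { toFun f := (exists_eq_prod hK f).choose
      map_update_add' f i a b := by
        ext x
        have h := fun f => ((exists_eq_prod hK f).choose_spec.1 x).trans
          (prodEval_apply (p x) f).symm
        rw [coe_add, Pi.add_apply, h, h, h, MultilinearMap.map_update_add]
      map_update_smul' f i c a := by
        ext x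
        have h := fun f => ((exists_eq_prod hK f).choose_spec.1 x).trans
          (prodEval_apply (p x) f).symm
        rw [coe_smul, Pi.smul_apply, h, h, MultilinearMap.map_update_smul] }
    1 fun f => by simpa using (exists_eq_prod hK f).choose_spec.2

theorem tensorMap_apply (hK : ∀ x y : Y, ⟪kerFun G x 1, kerFun G y 1⟫_ℝ =
      ∏ i, ⟪kerFun (H i) (p x i) 1, kerFun (H i) (p y i) 1⟫_ℝ) (f : ∀ i, H i) (x : Y) :
    tensorMap hK f x = ∏ i, f i (p x i) :=
  (exists_eq_prod hK f).choose_spec.1 x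

theorem tensorMap_kerFun (hK : ∀ x y : Y, ⟪kerFun G x 1, kerFun G y 1⟫_ℝ =
      ∏ i, ⟪kerFun (H i) (p x i) 1, kerFun (H i) (p y i) 1⟫_ℝ) (y : Y) :
    tensorMap hK (fun i => kerFun (H i) (p y i) 1) = kerFun G y 1 := by
  ext x
  rw [tensorMap_apply, ← inner_kerFun_one (kerFun G y 1), hK]
  simp only [inner_kerFun_one]

/-- With `f` fixed, both sides of the inner product formula are continuous and multilinear in `g`,
so tuples of kernel functions suffice. Surjectivity of `p` makes every such tuple come from a single
point of `Y`. -/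
theorem isHilbertTensorProduct_tensorMap (hp : Function.Surjective p)
    (hK : ∀ x y : Y, ⟪kerFun G x 1, kerFun G y 1⟫_ℝ =
      ∏ i, ⟪kerFun (H i) (p x i) 1, kerFun (H i) (p y i) 1⟫_ℝ) :
    IsHilbertTensorProduct (tensorMap hK).toMultilinearMap where
  inner_map_map f g := by
    have : (innerSL ℝ (tensorMap hK f)).compContinuousMultilinearMap (tensorMap hK) =
        (ContinuousMultilinearMap.mkPiAlgebra ℝ ι ℝ).compContinuousLinearMap
          fun i => innerSL ℝ (f i) := by
      refine ContinuousMultilinearMap.ext_of_dense_span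
        (fun i => dense_span_range_kerFun_one (H i)) fun g hg => ?_
      choose x hx using hg
      obtain ⟨y, rfl⟩ := hp x
      obtain rfl : (fun i => kerFun (H i) (p y i) 1) = g := funext hx
      simp only [ContinuousLinearMap.compContinuousMultilinearMap_coe, Function.comp_apply,
        ContinuousMultilinearMap.compContinuousLinearMap_apply, innerSL_apply_apply,
        ContinuousMultilinearMap.mkPiAlgebra_apply, tensorMap_kerFun, inner_kerFun_one,
        tensorMap_apply]
    simpa using DFunLike.congr_fun this g
  dense_span := by
    refine (dense_span_range_kerFun_one G).mono (Submodule.span_mono ?_)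
    rintro _ ⟨y, rfl⟩
    exact ⟨_, tensorMap_kerFun hK y⟩

end Tensor

end RKHS

/-- Hilbert tensor products are unique up to isometric isomorphism. -/
theorem IsHilbertTensorProduct.exists_linearIsometryEquiv {ι : Type*} [Fintype ι] {H : ι → Type*}
    [∀ i, NormedAddCommGroup (H i)] [∀ i, InnerProductSpace ℝ (H i)] [∀ i, CompleteSpace (H i)]
    {S T : Type*} [NormedAddCommGroup S] [InnerProductSpace ℝ S] [CompleteSpace S]
    [NormedAddCommGroup T] [InnerProductSpace ℝ T] [CompleteSpace T]
    {φ : MultilinearMap ℝ H S} {ψ : MultilinearMap ℝ H T}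
    (hφ : IsHilbertTensorProduct φ) (hψ : IsHilbertTensorProduct ψ) :
    ∃ U : T ≃ₗᵢ[ℝ] S, ∀ f, U (ψ f) = φ f := by
  set a := Finsupp.linearCombination ℝ (ψ : (∀ i, H i) → T) with ha
  set b := Finsupp.linearCombination ℝ (φ : (∀ i, H i) → S) with hb
  have hda : DenseRange a := by
    have := hψ.dense_span
    rwa [← Finsupp.range_linearCombination] at this
  have hdb : DenseRange b := by
    have := hφ.dense_span
    rwa [← Finsupp.range_linearCombination] at this
  -- Both norms expand into the same products of inner products in the `H i`, so the identity on
  -- formal combinations of tuples induces the isometry.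
  have hn : ∀ c, ‖b c‖ = ‖a c‖ := by
    intro c
    rw [norm_eq_sqrt_real_inner, norm_eq_sqrt_real_inner]
    simp only [ha, hb, Finsupp.linearCombination_apply, Finsupp.sum, inner_sum, sum_inner,
      real_inner_smul_right, real_inner_smul_left, hφ.inner_map_map, hψ.inner_map_map]
  refine ⟨(LinearEquiv.refl ℝ ((∀ i, H i) →₀ ℝ)).extendOfIsometry a b hda hdb hn, fun f => ?_⟩
  have := LinearEquiv.extendOfIsometry_eq (f := LinearEquiv.refl ℝ ((∀ i, H i) →₀ ℝ))
    (e₁ := a) (e₂ := b) hda hdb hn (Finsupp.single f 1)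
  simpa [ha, hb] using this

theorem PosSemidefKernel.inner_kerFun_nativeSpace {X : Type*} (K : PosSemidefKernel X) (Ω : Set X)
    (x y : Ω) : ⟪RKHS.kerFun (K.NativeSpace Ω) x 1, RKHS.kerFun (K.NativeSpace Ω) y 1⟫_ℝ =
      K.toFun x y := by
  rw [real_inner_comm, RKHS.inner_kerFun_one, RKHS.kerFun_apply, RKHS.OfKernel.kernel_ofKernel]
  simp [PosSemidefKernel.opMatrix, PosSemidefKernel.restrict]

theorem mainTheorem2 {M : ℕ} {d : Fin M → ℕ}
    (Ω : ∀ i, Set (EuclideanSpace ℝ (Fin (d i))))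
    (K : ∀ i, PosSemidefKernel (EuclideanSpace ℝ (Fin (d i)))) :
    ∃ φ : MultilinearMap ℝ (fun i => (K i).NativeSpace (Ω i))
        ((PosSemidefKernel.prod K).NativeSpace (Set.univ.pi Ω)),
      (∀ (f : ∀ i, (K i).NativeSpace (Ω i)) (x : Set.univ.pi Ω),
        φ f x = ∏ i, f i ⟨x.1 i, x.2 i (Set.mem_univ i)⟩) ∧
      IsHilbertTensorProduct φ ∧
      ∀ (T : Type*) [NormedAddCommGroup T] [InnerProductSpace ℝ T] [CompleteSpace T]
        (ψ : MultilinearMap ℝ (fun i => (K i).NativeSpace (Ω i)) T),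
        IsHilbertTensorProduct ψ →
          ∃ U : T ≃ₗᵢ[ℝ] (PosSemidefKernel.prod K).NativeSpace (Set.univ.pi Ω),
            ∀ f, U (ψ f) = φ f := by

  have hK : ∀ x y : Set.univ.pi Ω,
      ⟪RKHS.kerFun ((PosSemidefKernel.prod K).NativeSpace (Set.univ.pi Ω)) x 1,
        RKHS.kerFun ((PosSemidefKernel.prod K).NativeSpace (Set.univ.pi Ω)) y 1⟫_ℝ =
      ∏ i, ⟪RKHS.kerFun ((K i).NativeSpace (Ω i)) ⟨x.1 i, x.2 i (Set.mem_univ i)⟩ 1,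
        RKHS.kerFun ((K i).NativeSpace (Ω i)) ⟨y.1 i, y.2 i (Set.mem_univ i)⟩ 1⟫_ℝ := by
    intro x y
    simp only [PosSemidefKernel.inner_kerFun_nativeSpace]
    rfl
  have hφ := RKHS.isHilbertTensorProduct_tensorMap
    (p := fun (x : Set.univ.pi Ω) i => (⟨x.1 i, x.2 i (Set.mem_univ i)⟩ : Ω i))
    (fun z => ⟨⟨fun i => z i, fun i _ => (z i).2⟩, rfl⟩) hK
  exact ⟨_, RKHS.tensorMap_apply hK, hφ, fun T _ _ _ ψ hψ => hφ.exists_linearIsometryEquiv hψ⟩
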